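/- Let $G$ be a one-shot two-player game, simultaneous or sequential (in the sequential case Player 2 moves knowing Player 1's action), with countable action sets $A_1,A_2$ and bounded payoff functions $u_1,u_2:A_1\times A_2\to[0,\infty)$, the actions of each player being represented by binary strings, so that every string represents an action and every action is represented by a string. For $0<\epsilon,\delta\le 1$, the $(\epsilon,\delta)$-discounted time version of $G$ is the following game. Each player's pure strategies are all probabilistic Turing machines. Both players' machines receive $\lceil 1/\epsilon\rceil$ and $\lceil 1/\delta\rceil$ in binary as input; if $G$ is sequential, Player 2's machine receives the output of Player 1's machine as additional input (the empty string if that machine does not halt). Suppose Players 1 and 2 play $M$ and $N$. If a computation path $z$ of $M$ halts after $t(z)$ steps with an output representing $a\in A_1$, and a computation path $w$ of $N$ halts after $t(w)$ steps with an output representing $b\in A_2$, then Player 1 gets $(1-\epsilon)^{t(z)}u_1(a,b)$ and Player 2 gets $(1-\delta)^{t(w)}u_2(a,b)$. A player whose computation path does not halt gets $0$; if only $w$ does not halt, Player 1 gets $(1-\epsilon)^{t(z)}\sup_{b'\in A_2}u_1(a,b')$, and if only $z$ does not halt, Player 2 gets $(1-\delta)^{t(w)}\sup_{a'\in A_1}u_2(a',b)$.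 The payoffs for $(M,N)$ are the expectations of these quantities over the independent coin tosses of the two machines, and they are extended to mixed strategies (probability distributions on the set of probabilistic Turing machines) by expectation, the players choosing their machines independently. Then for all $0<\epsilon,\delta\le 1$ the $(\epsilon,\delta)$-discounted time version of $G$ has an $(\epsilon+\delta)$-Nash equilibrium in mixed strategies: there is a pair $(S,T)$ of mixed strategies such that neither player can increase its expected payoff by more than $\epsilon+\delta$ by playing a different mixed strategy while the opponent's strategy stays the same. -/

import Mathlib

open MeasureTheory
open scoped NNReal

namespace DiscountedGame

/-! ### Probabilistic Turing machines -/

/-- Tape symbols: the blank, a separator, the two bits, and `k` further symbols. -/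
inductive Sym (k : ℕ) where
  | blank
  | sep
  | bit (b : Bool)
  | aux (i : Fin k)

instance (k : ℕ) : Inhabited (Sym k) := ⟨Sym.blank⟩

/-- A probabilistic Turing machine, with any (finite) number of states, of further tape symbols
and of read-write tapes, and with a one-way write-only output tape. Every step uses one fair coin;
a machine which does not depend on the coins is a deterministic Turing machine.

Given the coin, the current state and the symbols under the heads, `trans` returns the next state
(`none` is the halting state), for each tape the symbol to write and the direction in which to move
the head (`none`: the head stays), and the bit to append to the output (`none`: no bit). -/
structure PTM where
  /-- there are `tapes + 1` read-write tapes; tape `0` holds the input at the start -/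
  tapes : ℕ
  /-- the number of tape symbols besides the blank, the separator and the bits -/
  syms : ℕ
  /-- there are `states + 1` non-halting states; the machine starts in state `0` -/
  states : ℕ
  trans : Bool → Fin (states + 1) → (Fin (tapes + 1) → Sym syms) →
    Option (Fin (states + 1)) × (Fin (tapes + 1) → Sym syms × Option Turing.Dir) × Option Bool

namespace PTM

/-- Configurations of a machine. -/
structure Cfg (M : PTM) where
  /-- the current state, `none` being the halting state -/
  state : Option (Fin (M.states + 1))
  tape : Fin (M.tapes + 1) → Turing.Tape (Sym M.syms)
  /-- the bits written on the output tape so far, in order -/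
  out : List Bool

/-- Inputs are strings over the bits and the separator (`none`). -/
def inputSym (k : ℕ) : Option Bool → Sym k
  | none => Sym.sep
  | some b => Sym.bit b

/-- The initial configuration: the first head is on the first symbol of the input. -/
def init (M : PTM) (input : List (Option Bool)) : M.Cfg where
  state := some 0
  tape := fun i => if i = 0 then Turing.Tape.mk₁ (input.map (inputSym M.syms)) else default
  out := []

/-- One step with coin `b`; a configuration in the halting state does not change. -/
def step (M : PTM) (b : Bool) (c : M.Cfg) : M.Cfg :=
  match c.state with
  | none => c
  | some q =>
    let r := M.trans b q (fun i => (c.tape i).head)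
    { state := r.1
      tape := fun i =>
        let T := (c.tape i).write (r.2.1 i).1
        match (r.2.1 i).2 with
        | none => T
        | some d => T.move d
      out := c.out ++ r.2.2.toList }

/-- The configuration after `t` steps on the given input, with the coins `ω 0, ω 1, …`. -/
def run (M : PTM) (input : List (Option Bool)) (ω : ℕ → Bool) : ℕ → M.Cfg
  | 0 => M.init input
  | t + 1 => M.step (ω t) (run M input ω t)

open Classical in
/-- The result of the computation path given by the coins `ω`: the output string and the number of
steps until the machine halts, or `none` if it never halts. -/
noncomputable def outcome (M : PTM) (input : List (Option Bool)) (ω : ℕ → Bool) :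
    Option (List Bool × ℕ) :=
  if h : ∃ t, (M.run input ω t).state = none then
    some ((M.run input ω (Nat.find h)).out, Nat.find h)
  else none

end PTM

/-- The law of an infinite sequence of independent fair coins. -/
noncomputable def coins : Measure (ℕ → Bool) :=
  Measure.infinitePi fun _ => (PMF.uniformOfFintype Bool).toMeasure

/-! ### Games -/

/-- In a simultaneous game each player moves without knowing the other's action; in a sequential
game player 2 moves with knowledge of the action of player 1. -/
inductive Order where
  | simultaneous
  | sequential

/-- A one-shot two-player game with non-negative payoffs. -/
structure Game (A₁ A₂ : Type*) where
  order : Order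
  u₁ : A₁ → A₂ → ℝ≥0
  u₂ : A₁ → A₂ → ℝ≥0

variable {A₁ A₂ : Type*}

/-- `1 / ε` and `1 / δ`, rounded up and written in binary (most significant bit first), and a
string `x`, as an input. -/
noncomputable def input (ε δ : ℝ) (x : List Bool) : List (Option Bool) :=
  (Nat.bits ⌈1 / ε⌉₊).reverse.map some ++ none ::
    ((Nat.bits ⌈1 / δ⌉₊).reverse.map some ++ none :: x.map some)

/-- The additional input of player 2: in a sequential game the output of player 1's machine (nothing
if that machine does not halt), in a simultaneous game nothing. -/
def additionalInput : Order → Option (List Bool × ℕ) → List Bool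
  | Order.sequential, some (x, _) => x
  | Order.sequential, none => []
  | Order.simultaneous, _ => []

/-- The payoff, discounted by `1 - ε` for each step of its own computation, of a player with
utility `v own other`, when the two computations have the results given: a player whose machine
does not halt gets `0`, and a player whose machine halts while the other's does not gets the best
payoff that its action can yield. The strings `x`, `y` stand for the actions `rep x`, `rep' y`. -/
noncomputable def discounted {A B : Type*} (v : A → B → ℝ≥0) (rep : List Bool → A)
    (rep' : List Bool → B) (ε : ℝ) :
    Option (List Bool × ℕ) → Option (List Bool × ℕ) → ℝ
  | none, _ => 0
  | some (x, t), some (y, _) => (1 - ε) ^ t * (v (rep x) (rep' y) : ℝ)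
  | some (x, t), none => (1 - ε) ^ t * ⨆ b : B, (v (rep x) b : ℝ)

/-- The expectation of `F` over independent computation paths of `M` (player 1) and `N`
(player 2) in the `(ε, δ)`-discounted version of a game with the given order of play. -/
noncomputable def expect (o : Order) (ε δ : ℝ) (M N : PTM)
    (F : Option (List Bool × ℕ) → Option (List Bool × ℕ) → ℝ) : ℝ :=
  ∫ ω₁, ∫ ω₂,
    F (M.outcome (input ε δ []) ω₁)
      (N.outcome (input ε δ (additionalInput o (M.outcome (input ε δ []) ω₁))) ω₂) ∂coins ∂coins

/-- The payoff of player 1 in the `(ε, δ)`-discounted version of `G` when the players play `M` and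
`N`; binary strings represent actions through `rep₁` and `rep₂`. -/
noncomputable def payoff₁ (G : Game A₁ A₂) (rep₁ : List Bool → A₁) (rep₂ : List Bool → A₂)
    (ε δ : ℝ) (M N : PTM) : ℝ :=
  expect G.order ε δ M N fun r s => discounted G.u₁ rep₁ rep₂ ε r s

/-- The payoff of player 2 in the `(ε, δ)`-discounted version of `G`. -/
noncomputable def payoff₂ (G : Game A₁ A₂) (rep₁ : List Bool → A₁) (rep₂ : List Bool → A₂)
    (ε δ : ℝ) (M N : PTM) : ℝ :=
  expect G.order ε δ M N fun r s => discounted (fun b a => G.u₂ a b) rep₂ rep₁ δ s r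

/-- The expected value of a payoff under independent mixed strategies, i.e. probability
distributions on the (countable) set of pure strategies. -/
noncomputable def mixed {P Q : Type*} (u : P → Q → ℝ) (S : PMF P) (T : PMF Q) : ℝ :=
  ∑' p, ∑' q, (S p).toReal * (T q).toReal * u p q

/-- `(S, T)` is an `η`-Nash equilibrium in mixed strategies of the game with payoffs `u`, `v`: no
player can increase its expected payoff by more than `η` by playing a different mixed strategy. -/
def IsApproxNash {P Q : Type*} (u v : P → Q → ℝ) (η : ℝ) (S : PMF P) (T : PMF Q) : Prop :=
  (∀ S' : PMF P, mixed u S' T ≤ mixed u S T + η) ∧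
    ∀ T' : PMF Q, mixed v S T' ≤ mixed v S T + η

end DiscountedGame

/-! An approximate equilibrium of a suitable finite subgame already works, with any positive error
in place of ε + δ.

Reduction. A machine of player 1 that halts after more than `T` steps earns at most `(1 - ε) ^ T *
K`, and within `T` steps at most `T` bits are written. Up to that tail, player 1's payoff against
`N` is therefore a sum, over finitely many results, of the probability of the result under `M` times
a coefficient depending only on `N` (`abs_payoff₁_sub_sum_le`). So finitely many machines
approximate all those of player 1, uniformly in `N` (`exists_finset_payoff₁_approx`). Once such a
net `E` is fixed, player 2's machines matter only through their bounded payoff vectors in `E → ℝ`,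
and so they have a finite net `F`. An approximate equilibrium on `E × F` resists all deviations
(`exists_isApproxNash`). Compactness is thus needed for player 1 only; in a sequential game player
2's machine faces infinitely many possible inputs.

Finite games. A two-player game with positive payoffs embeds in a symmetric game in which each
player may take either role. For a symmetric game, colour each grid point of the simplex by a best
reply to it; a Sperner-type lemma gives a cluster of nearby points on which every strategy either
has small weight or occurs as a colour, hence is nearly a best reply there.

The Sperner lemma is proved by parity. Call a dominant pair `(σ, C)` a room if `C.card = σ.card` and
a door if `C.card = σ.card + 1`. Every door lies next to two rooms, except that a door with no
points lies next to one. If no room had its indices as colours, every room would have an even number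
of doors missing only the colour `i₀`, while `(∅, {i₀})` makes the total number of incidences odd.
-/

namespace DiscountedGame

/-! ### An ordinal form of Sperner's lemma -/

section Dominance

variable {τ ι : Type*}

/-- No point of `τ` exceeds, in all orders `k i` with `i ∈ C`, some element of `σ`. -/
def Dominant (k : ι → τ → ℕ) (σ : Finset τ) (C : Finset ι) : Prop :=
  ∀ t, ∃ i ∈ C, ∀ s ∈ σ, k i t ≤ k i s

theorem Dominant.mono {k : ι → τ → ℕ} {σ σ' : Finset τ} {C C' : Finset ι}
    (h : Dominant k σ C) (hσ : σ' ⊆ σ) (hC : C ⊆ C') : Dominant k σ' C' := fun t =>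
  let ⟨i, hi, hs⟩ := h t
  ⟨i, hC hi, fun s hs' => hs s (hσ hs')⟩

-- Exactly one pair of elements of `E` collides under `f`, and the image survives the removal of an
-- element precisely when it belongs to that pair. This is the source of every "two" in the parity
-- argument.
open Classical in
theorem card_filter_image_erase_eq_two {α β : Type*} (f : α → β) (E : Finset α) (J : Finset β)
    (hc : E.card = J.card + 1) (hf : E.image f = J) :
    (E.filter fun e => (E.erase e).image f = J).card = 2 := by
  obtain ⟨a, ha, b, hb, hab, hfab⟩ := Finset.exists_ne_map_eq_of_card_lt_of_maps_to
    (s := E) (t := J) (f := f) (by omega) (fun x hx => by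
      rw [← hf]; exact Finset.mem_coe.2 (Finset.mem_image_of_mem f hx))
  have key : ∀ a b, a ∈ E → b ∈ E → a ≠ b → f a = f b → (E.erase a).image f = J := by
    intro a b ha hb hab hfab
    rw [← hf]
    refine Finset.Subset.antisymm (Finset.image_subset_image (Finset.erase_subset _ _)) ?_
    intro y hy
    obtain ⟨x, hx, rfl⟩ := Finset.mem_image.1 hy
    by_cases hxa : x = a
    · rw [hxa, hfab]
      exact Finset.mem_image_of_mem f (Finset.mem_erase.2 ⟨hab.symm, hb⟩)
    · exact Finset.mem_image_of_mem f (Finset.mem_erase.2 ⟨hxa, hx⟩)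
  rw [Finset.card_eq_two]
  refine ⟨a, b, hab, ?_⟩
  ext e
  simp only [Finset.mem_filter, Finset.mem_insert, Finset.mem_singleton]
  constructor
  · rintro ⟨he, himg⟩
    by_contra hne
    push Not at hne
    have hinj : Set.InjOn f (E.erase e) := by
      rw [← Finset.card_image_iff, himg, Finset.card_erase_of_mem he]
      omega
    exact hab (hinj (by simp [ha, hne.1.symm]) (by simp [hb, hne.2.symm]) hfab)
  · rintro (rfl | rfl)
    · exact ⟨ha, key _ _ ha hb hab hfab⟩
    · exact ⟨hb, key _ _ hb ha hab.symm hfab.symm⟩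

/-- In a dominant pair of equal cardinalities no point is least for two indices. -/
theorem Dominant.index_unique {k : ι → τ → ℕ} (hk : ∀ i, Function.Injective (k i))
    {σ : Finset τ} {C : Finset ι} (h : Dominant k σ C) (hc : C.card = σ.card)
    {x : τ} (hx : x ∈ σ) {i j : ι} (hi : i ∈ C) (hj : j ∈ C)
    (hxi : ∀ s ∈ σ, k i x ≤ k i s) (hxj : ∀ s ∈ σ, k j x ≤ k j s) : i = j := by
  classical
  have hmin : ∀ l, ∃ m ∈ σ, ∀ s ∈ σ, k l m ≤ k l s := fun l =>
    Finset.exists_min_image σ (k l) ⟨x, hx⟩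
  choose m hm hmm using hmin
  have huniq : ∀ l y, y ∈ σ → (∀ s ∈ σ, k l y ≤ k l s) → m l = y := fun l y hy hys =>
    hk l (le_antisymm (hmm l y hy) (hys _ (hm l)))
  -- Dominance tested at the points of `σ` makes `m` surjective onto `σ`; equal cardinalities then
  -- make it injective.
  have himg : C.image m = σ := by
    ext y
    refine ⟨fun hy => ?_, fun hy => ?_⟩
    · obtain ⟨l, -, rfl⟩ := Finset.mem_image.1 hy
      exact hm l
    · obtain ⟨l, hl, hls⟩ := h y
      exact Finset.mem_image.2 ⟨l, hl, huniq l y hy hls⟩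
  have hinj : Set.InjOn m C := by
    rw [← Finset.card_image_iff, himg, hc]
  exact hinj hi hj ((huniq i x hx hxi).trans (huniq j x hx hxj).symm)

/-- The pair `r` arises from the pair `d` by deleting the index `j`, or by adding a point which is
least for the index `j`. -/
def Via [DecidableEq τ] [DecidableEq ι] (k : ι → τ → ℕ) (d r : Finset τ × Finset ι) (j : ι) :
    Prop :=
  r = (d.1, d.2.erase j) ∨ ∃ x ∉ d.1, r = (insert x d.1, d.2) ∧ ∀ s ∈ d.1, k j x ≤ k j s

/-- The pair `d` arises from the pair `r` by deleting a point or adding an index. -/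
def Adj [DecidableEq τ] [DecidableEq ι] (r d : Finset τ × Finset ι) : Prop :=
  (∃ x ∈ r.1, d = (r.1.erase x, r.2)) ∨ ∃ j ∉ r.2, d = (r.1, insert j r.2)

/-! ### Doors and the rooms next to them -/

section

variable [DecidableEq τ] [DecidableEq ι]

theorem Via.adj {k : ι → τ → ℕ} {d r : Finset τ × Finset ι} {j : ι} (hj : j ∈ d.2)
    (h : Via k d r j) : Adj r d := by
  rcases h with rfl | ⟨x, hx, rfl, -⟩
  · exact Or.inr ⟨j, by simp, by simp [Finset.insert_erase hj]⟩
  · exact Or.inl ⟨x, by simp, by simp [Finset.erase_insert hx]⟩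

/-- If two different rooms arose via `j`, dominance of one, tested at the point added in the other,
would either make that point least for a second index or contradict the order of the two added
points under `k j`. -/
theorem via_unique {k : ι → τ → ℕ} (hk : ∀ i, Function.Injective (k i))
    {d r r' : Finset τ × Finset ι} {j : ι} (hj : j ∈ d.2)
    (hr : Dominant k r.1 r.2) (hrc : r.2.card = r.1.card)
    (hr' : Dominant k r'.1 r'.2) (hrc' : r'.2.card = r'.1.card)
    (h : Via k d r j) (h' : Via k d r' j) : r = r' := by
  have mixed : ∀ x ∉ d.1, Dominant k d.1 (d.2.erase j) → Dominant k (insert x d.1) d.2 →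
      d.2.card = (insert x d.1).card → (∀ s ∈ d.1, k j x ≤ k j s) → False := by
    intro x hx h1 h2 hc hxs
    obtain ⟨l, hl, hls⟩ := h1 x
    rw [Finset.mem_erase] at hl
    exact hl.1 (h2.index_unique hk hc (Finset.mem_insert_self x d.1) hl.2 hj
      (by simpa using hls) (by simpa using hxs))
  have added : ∀ x x', x ∉ d.1 → x' ∉ d.1 → Dominant k (insert x d.1) d.2 →
      Dominant k (insert x' d.1) d.2 → d.2.card = (insert x' d.1).card →
      (∀ s ∈ d.1, k j x' ≤ k j s) → k j x < k j x' → False := by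
    intro x x' hx hx' h1 h2 hc hxs hlt
    obtain ⟨l, hl, hls⟩ := h1 x'
    have hlj : l = j := h2.index_unique hk hc (Finset.mem_insert_self x' d.1) hl hj
      (by simpa using fun s hs => hls s (Finset.mem_insert_of_mem hs)) (by simpa using hxs)
    have := hls x (Finset.mem_insert_self x d.1)
    rw [hlj] at this
    omega
  rcases h with rfl | ⟨x, hx, rfl, hxs⟩ <;> rcases h' with rfl | ⟨x', hx', rfl, hxs'⟩
  · rfl
  · exact (mixed x' hx' hr hr' hrc' hxs').elim
  · exact (mixed x hx hr' hr hrc hxs).elim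
  · rcases lt_trichotomy (k j x) (k j x') with hlt | heq | hlt
    · exact (added x x' hx hx' hr hr' hrc' hxs' hlt).elim
    · rw [hk j heq]
    · exact (added x' x hx' hx hr' hr hrc hxs hlt).elim

/-- Indices which can be deleted so that each point stays least for some index. -/
def Free (k : ι → τ → ℕ) (d : Finset τ × Finset ι) (j : ι) : Prop :=
  ∀ s ∈ d.1, ∃ l ∈ d.2.erase j, ∀ s' ∈ d.1, k l s ≤ k l s'

/-- If deleting `j` destroys dominance, the greatest offending point in the order `k j` repairs it:
offenders are then dominated through `j`, the other points through their old index. -/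
theorem exists_via [Fintype τ] {k : ι → τ → ℕ}
    {d : Finset τ × Finset ι} (hd : Dominant k d.1 d.2) (hc : d.2.card = d.1.card + 1) {j : ι}
    (hj : j ∈ d.2) (hfree : Free k d j) :
    ∃ r : Finset τ × Finset ι, Dominant k r.1 r.2 ∧ r.2.card = r.1.card ∧ Via k d r j := by
  classical
  by_cases hdom : Dominant k d.1 (d.2.erase j)
  · exact ⟨(d.1, d.2.erase j), hdom, by rw [Finset.card_erase_of_mem hj]; simp [hc], Or.inl rfl⟩
  · set A : Finset τ := Finset.univ.filter fun t => ∀ l ∈ d.2.erase j, ∃ s ∈ d.1, k l s < k l t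
    have hA : A.Nonempty := by
      unfold Dominant at hdom
      push Not at hdom
      obtain ⟨t, ht⟩ := hdom
      exact ⟨t, by simpa [A] using ht⟩
    obtain ⟨x, hxA, hmax⟩ := Finset.exists_max_image A (k j) hA
    have hx' : ∀ l ∈ d.2.erase j, ∃ s ∈ d.1, k l s < k l x := (Finset.mem_filter.1 hxA).2
    have hx : x ∉ d.1 := by
      intro hx
      obtain ⟨l, hl, hls⟩ := hfree x hx
      obtain ⟨s, hs, hlt⟩ := hx' l hl
      exact absurd (hls s hs) (by omega)
    have hxj : ∀ s ∈ d.1, k j x ≤ k j s := by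
      obtain ⟨l, hl, hls⟩ := hd x
      by_cases hlj : l = j
      · rwa [hlj] at hls
      · obtain ⟨s, hs, hlt⟩ := hx' l (Finset.mem_erase.2 ⟨hlj, hl⟩)
        exact absurd (hls s hs) (by omega)
    refine ⟨(insert x d.1, d.2), ?_, ?_, Or.inr ⟨x, hx, rfl, hxj⟩⟩
    · intro t
      by_cases htA : t ∈ A
      · refine ⟨j, hj, fun s hs => ?_⟩
        rcases Finset.mem_insert.1 hs with rfl | hs
        · exact hmax t htA
        · exact (hmax t htA).trans (hxj s hs)
      · have : ∃ l ∈ d.2.erase j, ∀ s ∈ d.1, k l t ≤ k l s := by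
          by_contra hcon
          push Not at hcon
          exact htA (by simpa [A] using hcon)
        obtain ⟨l, hl, hls⟩ := this
        refine ⟨l, (Finset.mem_erase.1 hl).2, fun s hs => ?_⟩
        rcases Finset.mem_insert.1 hs with rfl | hs
        · obtain ⟨s', hs', hlt⟩ := hx' l hl
          exact (hls s' hs').trans hlt.le
        · exact hls s hs
    · simp [Finset.card_insert_of_notMem hx, hc]

/-- Every neighbour of equal cardinalities arises via a unique index, which is free. -/
theorem Adj.exists_free_via {k : ι → τ → ℕ} (hk : ∀ i, Function.Injective (k i))
    {d r : Finset τ × Finset ι} (hr : Dominant k r.1 r.2) (h : Adj r d) : ∃ j ∈ d.2, Free k d j ∧ Via k d r j := by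
  rcases h with ⟨x, hx, rfl⟩ | ⟨j, hj, rfl⟩
  · obtain ⟨j, hj, hjs⟩ := hr x
    refine ⟨j, hj, ?_, Or.inr ⟨x, by simp, by simp [Finset.insert_erase hx],
      fun s hs => hjs s (Finset.mem_erase.1 hs).2⟩⟩
    intro s hs
    rw [Finset.mem_erase] at hs
    obtain ⟨l, hl, hls⟩ := hr s
    refine ⟨l, Finset.mem_erase.2 ⟨?_, hl⟩, fun s' hs' => hls s' (Finset.mem_erase.1 hs').2⟩
    rintro rfl
    exact hs.1 (hk l (le_antisymm (hls x hx) (hjs s hs.2)))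
  · refine ⟨j, by simp, ?_, Or.inl (by simp [Finset.erase_insert hj])⟩
    intro s hs
    obtain ⟨l, hl, hls⟩ := hr s
    exact ⟨l, by simpa [Finset.erase_insert hj] using hl, hls⟩

theorem via_index_unique {k : ι → τ → ℕ} (hk : ∀ i, Function.Injective (k i))
    {d r : Finset τ × Finset ι} (hr : Dominant k r.1 r.2) (hc : r.2.card = r.1.card)
    {i j : ι} (hi : i ∈ d.2) (hj : j ∈ d.2) (h : Via k d r i) (h' : Via k d r j) : i = j := by
  rcases h with rfl | ⟨x, hx, rfl, hxs⟩ <;> rcases h' with h' | ⟨x', hx', h', hxs'⟩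
  · rw [Prod.mk.injEq] at h'
    by_contra hne
    have : j ∈ d.2.erase i := Finset.mem_erase.2 ⟨Ne.symm hne, hj⟩
    rw [h'.2] at this
    simp at this
  · rw [Prod.mk.injEq] at h'
    exact (hx' (h'.1 ▸ Finset.mem_insert_self x' d.1)).elim
  · rw [Prod.mk.injEq] at h'
    exact (hx (h'.1 ▸ Finset.mem_insert_self x d.1)).elim
  · rw [Prod.mk.injEq] at h'
    have hxx : x' = x := by
      have : x' ∈ insert x d.1 := h'.1 ▸ Finset.mem_insert_self x' d.1
      exact (Finset.mem_insert.1 this).resolve_right hx'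
    subst hxx
    exact hr.index_unique hk hc (Finset.mem_insert_self x' d.1) hi hj (by simpa using hxs)
      (by simpa using hxs')

end

-- Each free index leads to exactly one room, and each adjacent room comes from exactly one free
-- index.
open Classical in
theorem card_rooms_eq_card_free [Fintype τ] [Fintype ι] {k : ι → τ → ℕ}
    (hk : ∀ i, Function.Injective (k i)) {d : Finset τ × Finset ι} (hd : Dominant k d.1 d.2)
    (hc : d.2.card = d.1.card + 1) :
    (Finset.univ.filter fun r : Finset τ × Finset ι =>
      (Dominant k r.1 r.2 ∧ r.2.card = r.1.card) ∧ Adj r d).card =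
    (d.2.filter fun j => Free k d j).card := by
  symm
  refine Finset.card_bij (fun j hj => (exists_via hd hc (Finset.mem_filter.1 hj).1
    (Finset.mem_filter.1 hj).2).choose) ?_ ?_ ?_
  · intro j hj
    have hs := (exists_via hd hc (Finset.mem_filter.1 hj).1 (Finset.mem_filter.1 hj).2).choose_spec
    exact Finset.mem_filter.2 ⟨Finset.mem_univ _, ⟨hs.1, hs.2.1⟩,
      hs.2.2.adj (Finset.mem_filter.1 hj).1⟩
  · intro i hi j hj hij
    have hs := (exists_via hd hc (Finset.mem_filter.1 hi).1 (Finset.mem_filter.1 hi).2).choose_spec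
    have hs' := (exists_via hd hc (Finset.mem_filter.1 hj).1 (Finset.mem_filter.1 hj).2).choose_spec
    rw [← hij] at hs'
    exact via_index_unique hk hs.1 hs.2.1 (Finset.mem_filter.1 hi).1 (Finset.mem_filter.1 hj).1
      hs.2.2 hs'.2.2
  · intro r hr
    obtain ⟨-, ⟨hr1, hr2⟩, hadj⟩ := Finset.mem_filter.1 hr
    obtain ⟨j, hj, hf, hv⟩ := hadj.exists_free_via hk hr1
    have hs := (exists_via hd hc hj hf).choose_spec
    exact ⟨j, Finset.mem_filter.2 ⟨hj, hf⟩,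
      via_unique hk hj hs.1 hs.2.1 hr1 hr2 hs.2.2 hv⟩

-- Sending an index to its least point maps `d.2` onto `d.1` with one index to spare; an index is
-- free when this map stays onto without it.
open Classical in
theorem card_free_eq_two {k : ι → τ → ℕ} (hk : ∀ i, Function.Injective (k i))
    {d : Finset τ × Finset ι} (hd : Dominant k d.1 d.2) (hc : d.2.card = d.1.card + 1)
    (hne : d.1.Nonempty) : (d.2.filter fun j => Free k d j).card = 2 := by
  have hmin : ∀ l, ∃ m ∈ d.1, ∀ s ∈ d.1, k l m ≤ k l s := fun l =>
    Finset.exists_min_image d.1 (k l) hne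
  choose m hm hmm using hmin
  have huniq : ∀ l y, y ∈ d.1 → (∀ s ∈ d.1, k l y ≤ k l s) → m l = y := fun l y hy hys =>
    hk l (le_antisymm (hmm l y hy) (hys _ (hm l)))
  have himg : ∀ E : Finset ι, E.image m = d.1 ↔ ∀ s ∈ d.1, ∃ l ∈ E, ∀ s' ∈ d.1, k l s ≤ k l s' := by
    intro E
    constructor
    · intro h s hs
      rw [← h] at hs
      obtain ⟨l, hl, rfl⟩ := Finset.mem_image.1 hs
      exact ⟨l, hl, hmm l⟩
    · intro h
      ext y
      refine ⟨fun hy => ?_, fun hy => ?_⟩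
      · obtain ⟨l, -, rfl⟩ := Finset.mem_image.1 hy
        exact hm l
      · obtain ⟨l, hl, hls⟩ := h y hy
        exact Finset.mem_image.2 ⟨l, hl, huniq l y hy hls⟩
  rw [← card_filter_image_erase_eq_two m d.2 d.1 hc ((himg _).2 fun s _ => hd s)]
  congr 1
  ext j
  rw [Finset.mem_filter, Finset.mem_filter, himg]
  rfl

open Classical in
/-- In a pair of equal cardinalities whose colours do not agree with its indices, an even number of
neighbours have all colours but `i₀`. -/
theorem even_card_doors [Fintype τ] [Fintype ι] (c : τ → ι) (i₀ : ι) {r : Finset τ × Finset ι}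
    (hc : r.2.card = r.1.card) (hcol : r.1.image c ≠ r.2) :
    Even (Finset.univ.filter fun d : Finset τ × Finset ι =>
      (i₀ ∈ d.2 ∧ d.1.image c = d.2.erase i₀) ∧ d.2.card = d.1.card + 1 ∧ Adj r d).card := by
  obtain ⟨σ, C⟩ := r
  dsimp only at hc hcol
  -- Removing an element of `E` encodes passing to a door: a point of `σ` is deleted, or an index
  -- outside `C` is added. Counting each outside index as its own colour, the condition on the
  -- door's colours becomes that `f` takes all values but `i₀` on what is left of `E`.
  set E : Finset (τ ⊕ ι) := σ.disjSum Cᶜ with hE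
  set f : τ ⊕ ι → ι := Sum.elim c id with hf
  have hEc : E.card = (Finset.univ.erase i₀).card + 1 := by
    rw [Finset.card_erase_add_one (Finset.mem_univ i₀), hE, Finset.card_disjSum, Finset.card_univ,
      ← hc, Finset.card_add_card_compl]
  set g : τ ⊕ ι → Finset τ × Finset ι :=
    Sum.elim (fun x => (σ.erase x, C)) (fun j => (σ, insert j C)) with hg
  have hdoors : (Finset.univ.filter fun d : Finset τ × Finset ι =>
      (i₀ ∈ d.2 ∧ d.1.image c = d.2.erase i₀) ∧ d.2.card = d.1.card + 1 ∧ Adj (σ, C) d) =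
      (E.filter fun e => (E.erase e).image f = Finset.univ.erase i₀).image g := by
    have h1 : ∀ x ∈ σ, ((E.erase (Sum.inl x)).image f = Finset.univ.erase i₀ ↔
        i₀ ∈ C ∧ (σ.erase x).image c = C.erase i₀) := by
      intro x hx
      have himg : (E.erase (Sum.inl x)).image f = (σ.erase x).image c ∪ Cᶜ := by
        ext y
        simp [hE, hf, Finset.mem_image]
      rw [himg]
      constructor
      · intro h
        have hi : i₀ ∈ C := by
          by_contra hi
          have : i₀ ∈ (σ.erase x).image c ∪ Cᶜ := by simp [hi]
          rw [h] at this
          simp at this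
        refine ⟨hi, (Finset.eq_of_subset_of_card_le ?_ ?_).symm⟩
        · intro y hy
          rw [Finset.mem_erase] at hy
          have : y ∈ (σ.erase x).image c ∪ Cᶜ := by rw [h]; simp [hy.1]
          rcases Finset.mem_union.1 this with h' | h'
          · exact h'
          · exact absurd hy.2 (Finset.mem_compl.1 h')
        · refine Finset.card_image_le.trans ?_
          rw [Finset.card_erase_of_mem hx, Finset.card_erase_of_mem hi, hc]
      · rintro ⟨hi, h⟩
        rw [h]
        ext y
        simp only [Finset.mem_union, Finset.mem_erase, Finset.mem_compl, Finset.mem_univ, and_true]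
        constructor
        · rintro (h' | h')
          · exact h'.1
          · rintro rfl
            exact h' hi
        · tauto
    have h2 : ∀ j ∉ C, ((E.erase (Sum.inr j)).image f = Finset.univ.erase i₀ ↔
        i₀ ∈ insert j C ∧ σ.image c = (insert j C).erase i₀) := by
      intro j hj
      have himg : (E.erase (Sum.inr j)).image f = σ.image c ∪ Cᶜ.erase j := by
        ext y
        simp [hE, hf, Finset.mem_image]
      rw [himg]
      constructor
      · intro h
        have hi : i₀ ∈ insert j C := by
          by_contra hi
          rw [Finset.mem_insert, not_or] at hi
          have : i₀ ∈ σ.image c ∪ Cᶜ.erase j := by simp [hi]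
          rw [h] at this
          simp at this
        refine ⟨hi, (Finset.eq_of_subset_of_card_le ?_ ?_).symm⟩
        · intro y hy
          rw [Finset.mem_erase] at hy
          have : y ∈ σ.image c ∪ Cᶜ.erase j := by rw [h]; simp [hy.1]
          rcases Finset.mem_union.1 this with h' | h'
          · exact h'
          · rw [Finset.mem_erase, Finset.mem_compl] at h'
            rw [Finset.mem_insert] at hy
            tauto
        · refine Finset.card_image_le.trans ?_
          rw [Finset.card_erase_of_mem hi, Finset.card_insert_of_notMem hj, hc]
          simp
      · rintro ⟨hi, h⟩
        rw [h]
        ext y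
        simp only [Finset.mem_union, Finset.mem_erase, Finset.mem_compl, Finset.mem_univ, and_true,
          Finset.mem_insert]
        constructor
        · rintro (h' | h')
          · exact h'.1
          · rintro rfl
            rw [Finset.mem_insert] at hi
            tauto
        · tauto
    ext d
    simp only [Finset.mem_filter, Finset.mem_univ, true_and, Finset.mem_image, Sum.exists]
    constructor
    · rintro ⟨hd, -, ⟨x, hx, rfl⟩ | ⟨j, hj, rfl⟩⟩
      · exact Or.inl ⟨x, ⟨by simpa [hE] using hx, (h1 x hx).2 hd⟩, rfl⟩
      · exact Or.inr ⟨j, ⟨by simpa [hE] using hj, (h2 j hj).2 hd⟩, rfl⟩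
    · rintro (⟨x, ⟨hx, hx'⟩, rfl⟩ | ⟨j, ⟨hj, hj'⟩, rfl⟩)
      · have hx : x ∈ σ := by simpa [hE] using hx
        refine ⟨(h1 x hx).1 hx', ?_, Or.inl ⟨x, hx, rfl⟩⟩
        simp only [hg, Sum.elim_inl]
        rw [Finset.card_erase_add_one hx, hc]
      · have hj : j ∉ C := by simpa [hE] using hj
        refine ⟨(h2 j hj).1 hj', ?_, Or.inr ⟨j, hj, rfl⟩⟩
        simp only [hg, Sum.elim_inr]
        rw [Finset.card_insert_of_notMem hj, hc]
  have hginj : Set.InjOn g E := by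
    rintro (x | i) hx (y | j) hy hxy
    · have hx : x ∈ σ := by simpa [hE] using hx
      simp only [hg, Sum.elim_inl, Prod.mk.injEq, and_true] at hxy
      by_contra hne
      have : x ∈ σ.erase y := Finset.mem_erase.2 ⟨fun h => hne (by rw [h]), hx⟩
      rw [← hxy] at this
      simp at this
    · have hx : x ∈ σ := by simpa [hE] using hx
      simp only [hg, Sum.elim_inl, Sum.elim_inr, Prod.mk.injEq] at hxy
      rw [← hxy.1] at hx
      simp at hx
    · have hy : y ∈ σ := by simpa [hE] using hy
      simp only [hg, Sum.elim_inl, Sum.elim_inr, Prod.mk.injEq] at hxy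
      rw [hxy.1] at hy
      simp at hy
    · have hi : i ∉ C := by simpa [hE] using hx
      simp only [hg, Sum.elim_inr, Prod.mk.injEq, true_and] at hxy
      have : i ∈ insert j C := hxy ▸ Finset.mem_insert_self i C
      rw [(Finset.mem_insert.1 this).resolve_right hi]
  rw [hdoors, Finset.card_image_of_injOn (hginj.mono fun e he => (Finset.mem_filter.1 he).1)]
  by_cases himg : E.image f = Finset.univ.erase i₀
  · refine (congrArg Even ?_).mpr even_two
    convert card_filter_image_erase_eq_two f E _ hEc himg
  · rw [Finset.filter_false_of_mem, Finset.card_empty]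
    · exact Even.zero
    · intro e he hcon
      -- A suitable `e` would force `f` to be onto `ι`, that is `σ.image c = C`, or to have image
      -- `univ.erase i₀`; both are excluded.
      have himg' : E.image f = insert (f e) (Finset.univ.erase i₀) := by
        rw [← hcon, ← Finset.image_insert, Finset.insert_erase he]
      by_cases hfe : f e = i₀
      · rw [hfe, Finset.insert_erase (Finset.mem_univ _)] at himg'
        refine hcol (Finset.eq_of_subset_of_card_le ?_ ?_).symm
        · intro y hy
          have : y ∈ E.image f := by rw [himg']; simp
          simp only [hE, hf, Finset.mem_image, Sum.exists, Finset.inl_mem_disjSum,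
            Finset.inr_mem_disjSum, Sum.elim_inl, Sum.elim_inr, Finset.mem_compl, id] at this
          rcases this with ⟨x, hx, rfl⟩ | ⟨x, hx, rfl⟩
          · exact Finset.mem_image_of_mem c hx
          · exact absurd hy hx
        · rw [hc]
          exact Finset.card_image_le
      · rw [Finset.insert_eq_of_mem (by simp [hfe])] at himg'
        exact himg himg'

open Classical in
/-- For every colouring there is a dominant set of points whose colours are distinct and are the
indices with respect to which it is dominant. -/
theorem exists_dominant_image_eq [Fintype τ] [Fintype ι] [Nonempty τ] {k : ι → τ → ℕ}
    (hk : ∀ i, Function.Injective (k i)) (c : τ → ι) :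
    ∃ σ : Finset τ, Dominant k σ (σ.image c) := by
  by_contra hcon
  push Not at hcon
  obtain ⟨t₀⟩ := ‹Nonempty τ›
  set i₀ := c t₀
  set R : Finset (Finset τ × Finset ι) :=
    Finset.univ.filter fun r => Dominant k r.1 r.2 ∧ r.2.card = r.1.card
  set D : Finset (Finset τ × Finset ι) := Finset.univ.filter fun d =>
    Dominant k d.1 d.2 ∧ (i₀ ∈ d.2 ∧ d.1.image c = d.2.erase i₀) ∧ d.2.card = d.1.card + 1
  have hcount : ∑ r ∈ R, (D.filter fun d => Adj r d).card =
      ∑ d ∈ D, (R.filter fun r => Adj r d).card :=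
    Finset.sum_card_bipartiteAbove_eq_sum_card_bipartiteBelow Adj
  have hleft : Even (∑ r ∈ R, (D.filter fun d => Adj r d).card) := by
    refine Finset.even_sum _ fun r hr => ?_
    obtain ⟨-, hr1, hr2⟩ := Finset.mem_filter.1 hr
    have := even_card_doors c i₀ hr2 (fun h => hcon r.1 (h.symm ▸ hr1))
    refine (congrArg Even (congrArg Finset.card ?_)).mpr this
    ext d
    simp only [D, Finset.mem_filter, Finset.mem_univ, true_and]
    constructor
    · tauto
    · rintro ⟨h1, h2, h3⟩
      refine ⟨⟨?_, h1, h2⟩, h3⟩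
      rcases h3 with ⟨x, hx, rfl⟩ | ⟨j, hj, rfl⟩
      · exact hr1.mono (Finset.erase_subset _ _) subset_rfl
      · exact hr1.mono subset_rfl (Finset.subset_insert _ _)
  have hrooms : ∀ d ∈ D, (R.filter fun r => Adj r d).card = (d.2.filter fun j => Free k d j).card := by
    intro d hd
    obtain ⟨-, hd1, -, hd2⟩ := Finset.mem_filter.1 hd
    rw [← card_rooms_eq_card_free hk hd1 hd2, Finset.filter_filter]
  have hstart : ((∅, {i₀}) : Finset τ × Finset ι) ∈ D :=
     Finset.mem_filter.2 ⟨Finset.mem_univ _, by simp [Dominant], by simp⟩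
  have hright : Odd (∑ d ∈ D, (R.filter fun r => Adj r d).card) := by
    rw [← Finset.add_sum_erase D _ hstart]
    refine Odd.add_even ?_ (Finset.even_sum _ fun d hd => ?_)
    · rw [hrooms _ hstart]
      simp [Free, Finset.filter_true_of_mem]
    · obtain ⟨hne, hd⟩ := Finset.mem_erase.1 hd
      rw [hrooms d hd]
      obtain ⟨-, hd1, ⟨hi, hd3⟩, hd2⟩ := Finset.mem_filter.1 hd
      rw [card_free_eq_two hk hd1 hd2]
      · exact even_two
      · rw [Finset.nonempty_iff_ne_empty]
        intro he
        refine hne (Prod.ext he ?_)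
        rw [he, Finset.card_empty, zero_add, Finset.card_eq_one] at hd2
        obtain ⟨a, ha⟩ := hd2
        rw [ha, Finset.mem_singleton] at hi
        rw [ha, hi]
  rw [hcount] at hleft
  exact (Nat.not_even_iff_odd.2 hright) hleft

end Dominance

end DiscountedGame

namespace DiscountedGame

/-! ### Approximate equilibria of finite games -/

section FiniteGames

/-- A colouring of the points of the simplex `∑ i, s i = N` with natural coordinates by the
vertices: some point is, up to vertices of small weight, close to points of all colours. -/
theorem exists_grid_point {ι : Type*} [Fintype ι] (c : (ι → ℕ) → ι) (N : ℕ) :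
    ∃ s₀ : ι → ℕ, ∑ i, s₀ i = N ∧ ∀ i, s₀ i ≤ Fintype.card ι ∨
      ∃ s : ι → ℕ, ∑ i, s i = N ∧ c s = i ∧
        ∀ l, s l ≤ s₀ l + Fintype.card ι ∧ s₀ l ≤ s l + Fintype.card ι := by
  classical
  let τ := Finset.piAntidiag (Finset.univ : Finset ι) N
  have hsum : ∀ t : τ, ∑ i, (t : ι → ℕ) i = N := fun t => (Finset.mem_piAntidiag.1 t.2).1
  have hmk : ∀ t : ι → ℕ, ∑ i, t i = N → t ∈ τ := fun t ht =>
    Finset.mem_piAntidiag.2 ⟨ht, by simp⟩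
  -- The colouring itself shows that `ι` is nonempty.
  have i₁ : ι := c fun _ => 0
  have : Nonempty τ := ⟨⟨Pi.single i₁ N, hmk _ (by simp)⟩⟩
  let m := Fintype.card τ
  let e : τ ≃ Fin m := Fintype.equivFin τ
  -- Order by the `i`-th coordinate, with ties broken by the enumeration `e`.
  let k : ι → τ → ℕ := fun i t => (t : ι → ℕ) i * m + e t
  have hkle : ∀ i t s, k i t ≤ k i s → (t : ι → ℕ) i ≤ (s : ι → ℕ) i := by
    intro i t s h
    by_contra! hlt
    have h1 : ((s : ι → ℕ) i + 1) * m ≤ (t : ι → ℕ) i * m := Nat.mul_le_mul_right m hlt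
    have h2 := (e s).2
    simp only [k] at h
    rw [add_mul, one_mul] at h1
    omega
  have hk : ∀ i, Function.Injective (k i) := by
    intro i t s h
    have h1 := le_antisymm (hkle i t s h.le) (hkle i s t h.ge)
    simp only [k, h1, add_right_inj] at h
    exact e.injective (Fin.ext h)
  obtain ⟨σ, hσ⟩ := exists_dominant_image_eq hk (fun t : τ => c t)
  set C := σ.image fun t : τ => c t
  have hσne : σ.Nonempty := by
    obtain ⟨i, hi, -⟩ := hσ (Classical.arbitrary τ)
    obtain ⟨s, hs, -⟩ := Finset.mem_image.1 hi
    exact ⟨s, hs⟩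
  have hmin : ∀ i, ∃ m, (∃ s ∈ σ, (s : ι → ℕ) i = m) ∧ ∀ s ∈ σ, m ≤ (s : ι → ℕ) i := fun i => by
    obtain ⟨s, hs, h⟩ := Finset.exists_min_image σ (fun s : τ => (s : ι → ℕ) i) hσne
    exact ⟨_, ⟨s, hs, rfl⟩, h⟩
  choose μ hμ hμle using hmin
  -- Otherwise a grid point with all its `C`-coordinates above the minima `μ` would violate
  -- dominance. Hence the minima use up all but less than `Fintype.card ι` of the total `N`, which
  -- confines `σ` to a small cluster.
  have hbig : N < ∑ i ∈ C, (μ i + 1) := by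
    by_contra! hle
    obtain ⟨i₂, hi₂, -⟩ := hσ (Classical.arbitrary τ)
    let t : ι → ℕ := fun i => (if i ∈ C then μ i + 1 else 0) +
      if i = i₂ then N - ∑ i ∈ C, (μ i + 1) else 0
    have ht : ∑ i, t i = N := by
      simp only [t, Finset.sum_add_distrib, Finset.sum_ite_mem, Finset.univ_inter,
        Finset.sum_ite_eq', Finset.mem_univ, if_true]
      simp only [Finset.sum_add_distrib] at hle ⊢
      omega
    obtain ⟨i, hi, his⟩ := hσ ⟨t, hmk t ht⟩
    obtain ⟨s, hs, hsm⟩ := hμ i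
    have := hkle _ _ _ (his s hs)
    simp only [t, hi, if_true, hsm] at this
    omega
  have hcard : ∑ i ∈ C, (μ i + 1) ≤ ∑ i ∈ C, μ i + Fintype.card ι := by
    rw [Finset.sum_add_distrib]
    simpa using Finset.card_le_univ C
  have hin : ∀ s ∈ σ, ∀ i ∈ C, (s : ι → ℕ) i ≤ μ i + Fintype.card ι := by
    intro s hs i hi
    have h1 : ∑ j ∈ C, (s : ι → ℕ) j ≤ N :=
      (Finset.sum_le_univ_sum_of_nonneg fun _ => Nat.zero_le _).trans_eq (hsum s)
    have h2 : ∑ j ∈ C.erase i, μ j ≤ ∑ j ∈ C.erase i, (s : ι → ℕ) j :=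
      Finset.sum_le_sum fun j _ => hμle j s hs
    rw [← Finset.add_sum_erase C _ hi] at h1
    rw [← Finset.add_sum_erase C μ hi] at hcard
    omega
  have hout : ∀ s ∈ σ, ∀ i ∉ C, (s : ι → ℕ) i ≤ Fintype.card ι := by
    intro s hs i hi
    have h1 : ∑ j ∈ insert i C, (s : ι → ℕ) j ≤ N :=
      (Finset.sum_le_univ_sum_of_nonneg fun _ => Nat.zero_le _).trans_eq (hsum s)
    have h2 : ∑ j ∈ C, μ j ≤ ∑ j ∈ C, (s : ι → ℕ) j :=
      Finset.sum_le_sum fun j _ => hμle j s hs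
    rw [Finset.sum_insert hi] at h1
    omega
  have hclose : ∀ s ∈ σ, ∀ s' ∈ σ, ∀ l, (s : ι → ℕ) l ≤ (s' : ι → ℕ) l + Fintype.card ι := by
    intro s hs s' hs' l
    by_cases hl : l ∈ C
    · have := hin s hs l hl
      have := hμle l s' hs'
      omega
    · have := hout s hs l hl
      omega
  obtain ⟨s₀, hs₀⟩ := hσne
  refine ⟨s₀, hsum s₀, fun i => ?_⟩
  by_cases hi : i ∈ C
  · obtain ⟨s, hs, hsi⟩ := Finset.mem_image.1 hi
    exact Or.inr ⟨s, hsum s, hsi, fun l => ⟨hclose s hs s₀ hs₀ l, hclose s₀ hs₀ s hs l⟩⟩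
  · exact Or.inl (hout s₀ hs₀ i hi)

/-- Approximate symmetric equilibria of symmetric games. -/
theorem exists_approx_symmetric {ι : Type*} [Fintype ι] [Nonempty ι] (C : ι → ι → ℝ) {B : ℝ}
    (hC : ∀ i j, 0 ≤ C i j) (hCB : ∀ i j, C i j ≤ B) {η : ℝ} (hη : 0 < η) :
    ∃ z : ι → ℝ, (∀ i, 0 ≤ z i) ∧ ∑ i, z i = 1 ∧
      ∀ j, ∑ l, C j l * z l ≤ ∑ i, z i * ∑ l, C i l * z l + η := by
  set n : ℝ := (Fintype.card ι : ℝ) with hn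
  have hn1 : 1 ≤ n := by
    rw [hn]
    exact_mod_cast Fintype.card_pos (α := ι)
  have hB : 0 ≤ B := (hC _ _).trans (hCB (Classical.arbitrary ι) (Classical.arbitrary ι))
  -- Each of the `n` strategies contributes an error `2 * B * n ^ 2 * N` before division by `N ^ 2`;
  -- the `+ 1` keeps `N` positive when `B = 0`.
  obtain ⟨N, hN⟩ := exists_nat_ge (2 * B * n ^ 3 / η + 1)
  have hN1 : (1 : ℝ) ≤ N := le_trans (by
    have : 0 ≤ 2 * B * n ^ 3 / η := by positivity
    linarith) hN
  have hNη : 2 * B * n ^ 3 ≤ N * η := by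
    rw [← div_le_iff₀ hη]
    linarith
  -- The colour of a grid point is a best reply to it.
  have hbest : ∀ s : ι → ℕ, ∃ i, ∀ j, ∑ l, C j l * s l ≤ ∑ l, C i l * s l := fun s => by
    obtain ⟨i, -, hi⟩ := Finset.exists_max_image Finset.univ (fun i => ∑ l, C i l * s l)
      Finset.univ_nonempty
    exact ⟨i, fun j => hi j (Finset.mem_univ j)⟩
  choose c hc using hbest
  obtain ⟨s₀, hsum, hs₀⟩ := exists_grid_point c N
  have hsumR : ∑ i, (s₀ i : ℝ) = N := by exact_mod_cast hsum
  have hdiff : ∀ s s' : ι → ℕ, (∀ l, s l ≤ s' l + Fintype.card ι) → ∀ j,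
      ∑ l, C j l * s l ≤ ∑ l, C j l * s' l + B * n ^ 2 := by
    intro s s' h j
    have : ∑ l, C j l * (s l : ℝ) ≤ ∑ l, (C j l * (s' l : ℝ) + B * n) := by
      refine Finset.sum_le_sum fun l _ => ?_
      have h1 : (s l : ℝ) ≤ s' l + n := by
        rw [hn]
        exact_mod_cast h l
      calc C j l * (s l : ℝ) ≤ C j l * (s' l + n) := mul_le_mul_of_nonneg_left h1 (hC j l)
        _ = C j l * s' l + C j l * n := by ring
        _ ≤ C j l * s' l + B * n := by
          have := mul_le_mul_of_nonneg_right (hCB j l) (zero_le_one.trans hn1)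
          linarith
    refine this.trans_eq ?_
    rw [Finset.sum_add_distrib, Finset.sum_const, Finset.card_univ, nsmul_eq_mul, ← hn]
    ring
  have hterm : ∀ i j, (s₀ i : ℝ) * ∑ l, C j l * s₀ l ≤
      s₀ i * ∑ l, C i l * s₀ l + 2 * B * n ^ 2 * N := by
    intro i j
    have h0 : ∀ i, 0 ≤ ∑ l, C i l * (s₀ l : ℝ) := fun i =>
      Finset.sum_nonneg fun l _ => mul_nonneg (hC i l) (Nat.cast_nonneg _)
    have h1 : ∑ l, C j l * (s₀ l : ℝ) ≤ B * N := by
      rw [← hsumR, Finset.mul_sum]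
      exact Finset.sum_le_sum fun l _ => mul_le_mul_of_nonneg_right (hCB j l) (Nat.cast_nonneg _)
    rcases hs₀ i with h | ⟨s, -, rfl, hclose⟩
    · have h2 : (s₀ i : ℝ) ≤ n := by
        rw [hn]
        exact_mod_cast h
      calc (s₀ i : ℝ) * ∑ l, C j l * s₀ l ≤ n * (B * N) :=
          mul_le_mul h2 h1 (h0 j) (zero_le_one.trans hn1)
        _ ≤ 2 * B * n ^ 2 * N := by
          have : 0 ≤ B * N * n * (2 * n - 1) := by
            have : 0 ≤ 2 * n - 1 := by linarith
            positivity
          linarith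
        _ ≤ _ := le_add_of_nonneg_left (mul_nonneg (Nat.cast_nonneg _) (h0 i))
    · have h2 := hdiff s₀ s (fun l => (hclose l).2) j
      have h3 := hdiff s s₀ (fun l => (hclose l).1) (c s)
      have h4 := hc s j
      have h5 : (s₀ (c s) : ℝ) ≤ N := by
        rw [← hsumR]
        exact Finset.single_le_sum (f := fun i => (s₀ i : ℝ)) (fun i _ => Nat.cast_nonneg _)
          (Finset.mem_univ _)
      calc (s₀ (c s) : ℝ) * ∑ l, C j l * s₀ l
          ≤ s₀ (c s) * (∑ l, C (c s) l * s₀ l + 2 * B * n ^ 2) := by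
            gcongr
            linarith
        _ = s₀ (c s) * ∑ l, C (c s) l * s₀ l + s₀ (c s) * (2 * B * n ^ 2) := by ring
        _ ≤ s₀ (c s) * ∑ l, C (c s) l * s₀ l + N * (2 * B * n ^ 2) := by gcongr
        _ = _ := by ring
  have hN0 : (N : ℝ) ≠ 0 := by linarith
  refine ⟨fun i => s₀ i / N, fun i => by positivity, ?_, fun j => ?_⟩
  · rw [← Finset.sum_div, hsumR, div_self hN0]
  · have hscale : ∀ i, ∑ l, C i l * ((s₀ l : ℝ) / N) = (∑ l, C i l * s₀ l) / N := fun i => by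
      rw [Finset.sum_div]
      exact Finset.sum_congr rfl fun l _ => by ring
    simp only [hscale]
    have hall := Finset.sum_le_sum fun i (_ : i ∈ Finset.univ) => hterm i j
    rw [← Finset.sum_mul, hsumR, Finset.sum_add_distrib, Finset.sum_const, Finset.card_univ,
      nsmul_eq_mul, ← hn] at hall
    have heq : ∑ i, (s₀ i : ℝ) / N * ((∑ l, C i l * s₀ l) / N) =
        (∑ i, (s₀ i : ℝ) * ∑ l, C i l * s₀ l) / N ^ 2 := by
      rw [Finset.sum_div]
      exact Finset.sum_congr rfl fun i _ => by ring
    have hN2 : (0 : ℝ) < N ^ 2 := by positivity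
    rw [heq, ← sub_le_iff_le_add', div_sub_div _ _ hN0 hN2.ne', div_le_iff₀ (by positivity)]
    have h6 : n * (2 * B * n ^ 2 * N) ≤ N ^ 2 * η := by
      calc n * (2 * B * n ^ 2 * N) = N * (2 * B * n ^ 3) := by ring
        _ ≤ N * (N * η) := by gcongr
        _ = _ := by ring
    calc _ = N * (N * ∑ l, C j l * s₀ l - ∑ i, (s₀ i : ℝ) * ∑ l, C i l * s₀ l) := by ring
      _ ≤ N * (N ^ 2 * η) := by
        gcongr
        linarith
      _ = _ := by ring

/-- Symmetrize: on `α ⊕ β` a strategy earns only against the other side. Payoffs of at least `1`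
force both sides to carry substantial weight, so the two halves can be normalized. -/
theorem exists_approx_bimatrix_of_mem_Icc {α β : Type*} [Fintype α] [Fintype β] [Nonempty α]
    [Nonempty β] (u v : α → β → ℝ) (hu : ∀ a b, u a b ∈ Set.Icc 1 2)
    (hv : ∀ a b, v a b ∈ Set.Icc 1 2) {η : ℝ} (hη : 0 < η) :
    ∃ (x : α → ℝ) (y : β → ℝ), (∀ a, 0 ≤ x a) ∧ ∑ a, x a = 1 ∧ (∀ b, 0 ≤ y b) ∧ ∑ b, y b = 1 ∧
      (∀ a, ∑ b, u a b * y b ≤ ∑ a, x a * ∑ b, u a b * y b + η) ∧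
      ∀ b, ∑ a, v a b * x a ≤ ∑ b, y b * ∑ a, v a b * x a + η := by
  set κ := min (1 / 4) (η / 16) with hκ
  have hκ0 : 0 < κ := lt_min (by norm_num) (by positivity)
  have hκ1 : κ ≤ 1 / 4 := min_le_left _ _
  have hκ2 : κ ≤ η / 16 := min_le_right _ _
  obtain ⟨z, hz0, hz1, hz⟩ := exists_approx_symmetric (ι := α ⊕ β)
    (Sum.elim (fun a => Sum.elim (fun _ => 0) (fun b => u a b))
      (fun b => Sum.elim (fun a => v a b) (fun _ => 0))) (B := 2)
    (by
      rintro (a | b) (a' | b') <;> simp only [Sum.elim_inl, Sum.elim_inr, le_refl]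
      · exact zero_le_one.trans (hu a b').1
      · exact zero_le_one.trans (hv a' b).1)
    (by
      rintro (a | b) (a' | b') <;> simp only [Sum.elim_inl, Sum.elim_inr, zero_le_two]
      · exact (hu a b').2
      · exact (hv a' b).2) hκ0
  simp only [Fintype.sum_sum_type, Sum.forall, Sum.elim_inl, Sum.elim_inr, zero_mul,
    Finset.sum_const_zero, zero_add, add_zero] at hz0 hz1 hz
  obtain ⟨hx0, hy0⟩ := hz0
  obtain ⟨hzP, hzQ⟩ := hz
  set p := ∑ a, z (Sum.inl a) with hp
  set q := ∑ b, z (Sum.inr b) with hq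
  set X := ∑ a, z (Sum.inl a) * ∑ b, u a b * z (Sum.inr b) with hX
  set Y := ∑ b, z (Sum.inr b) * ∑ a, v a b * z (Sum.inl a) with hY
  have hp0 : 0 ≤ p := Finset.sum_nonneg fun a _ => hx0 a
  have hq0 : 0 ≤ q := Finset.sum_nonneg fun b _ => hy0 b
  have hP1 : ∀ a, q ≤ ∑ b, u a b * z (Sum.inr b) := fun a =>
    Finset.sum_le_sum fun b _ => le_mul_of_one_le_left (hy0 b) (hu a b).1
  have hP2 : ∀ a, ∑ b, u a b * z (Sum.inr b) ≤ 2 * q := fun a => by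
    rw [hq, Finset.mul_sum]
    exact Finset.sum_le_sum fun b _ => mul_le_mul_of_nonneg_right (hu a b).2 (hy0 b)
  have hQ1 : ∀ b, p ≤ ∑ a, v a b * z (Sum.inl a) := fun b =>
    Finset.sum_le_sum fun a _ => le_mul_of_one_le_left (hx0 a) (hv a b).1
  have hQ2 : ∀ b, ∑ a, v a b * z (Sum.inl a) ≤ 2 * p := fun b => by
    rw [hp, Finset.mul_sum]
    exact Finset.sum_le_sum fun a _ => mul_le_mul_of_nonneg_right (hv a b).2 (hx0 a)
  have hXle : ∀ w, (∀ a, ∑ b, u a b * z (Sum.inr b) ≤ w) → X ≤ p * w := fun w hw => by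
    rw [hp, Finset.sum_mul]
    exact Finset.sum_le_sum fun a _ => mul_le_mul_of_nonneg_left (hw a) (hx0 a)
  have hYle : ∀ w, (∀ b, ∑ a, v a b * z (Sum.inl a) ≤ w) → Y ≤ q * w := fun w hw => by
    rw [hq, Finset.sum_mul]
    exact Finset.sum_le_sum fun b _ => mul_le_mul_of_nonneg_left (hw b) (hy0 b)
  have hX2 := hXle _ hP2
  have hY2 := hYle _ hQ2
  have hXW := hXle _ hzP
  have hYW := hYle _ hzQ
  have hqW : q ≤ X + Y + κ := (hP1 (Classical.arbitrary α)).trans (hzP _)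
  have hpW : p ≤ X + Y + κ := (hQ1 (Classical.arbitrary β)).trans (hzQ _)
  -- From `p + q = 1`, the two bounds above and `X, Y ≤ 2 * p * q`: `1 ≤ 2 * (X + Y) + 2 * κ ≤ 8 * p
  -- * q + 1 / 2`.
  have hpq : 1 / 16 ≤ p * q := by linarith
  have hp' : 0 < p := hp0.lt_of_ne fun h => by rw [← h] at hpq; norm_num at hpq
  have hq' : 0 < q := hq0.lt_of_ne fun h => by rw [← h] at hpq; norm_num at hpq
  have hκpq : κ ≤ η * (p * q) := by nlinarith
  have hsu : ∀ a, ∑ b, u a b * (z (Sum.inr b) / q) = (∑ b, u a b * z (Sum.inr b)) / q := fun a => by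
    rw [Finset.sum_div]
    exact Finset.sum_congr rfl fun l _ => by ring
  have hsv : ∀ b, ∑ a, v a b * (z (Sum.inl a) / p) = (∑ a, v a b * z (Sum.inl a)) / p := fun b => by
    rw [Finset.sum_div]
    exact Finset.sum_congr rfl fun l _ => by ring
  refine ⟨fun a => z (Sum.inl a) / p, fun b => z (Sum.inr b) / q,
    fun a => div_nonneg (hx0 a) hp0, ?_, fun b => div_nonneg (hy0 b) hq0, ?_, fun a => ?_,
    fun b => ?_⟩
  · rw [← Finset.sum_div, div_self hp'.ne']
  · rw [← Finset.sum_div, div_self hq'.ne']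
  · have : ∑ a, z (Sum.inl a) / p * ((∑ b, u a b * z (Sum.inr b)) / q) = X / (p * q) := by
      rw [hX, Finset.sum_div]
      exact Finset.sum_congr rfl fun l _ => by field_simp
    simp only [hsu, this]
    -- With `W = X + Y + κ`, the bound `Y ≤ q * W` and `p + q = 1` give `p * W ≤ X + κ`, and `κ ≤ η
    -- * (p * q)`.
    have h1 := hzP a
    have h2 : X / (p * q) + η = ((X + η * (p * q)) / p) / q := by field_simp
    rw [h2]
    refine div_le_div_of_nonneg_right ?_ hq0
    rw [le_div_iff₀ hp']
    nlinarith [mul_le_mul_of_nonneg_right h1 hp0]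
  · have : ∑ b, z (Sum.inr b) / q * ((∑ a, v a b * z (Sum.inl a)) / p) = Y / (p * q) := by
      rw [hY, Finset.sum_div]
      exact Finset.sum_congr rfl fun l _ => by field_simp
    simp only [hsv, this]
    have h1 := hzQ b
    have h2 : Y / (p * q) + η = ((Y + η * (p * q)) / q) / p := by field_simp
    rw [h2]
    refine div_le_div_of_nonneg_right ?_ hp0
    rw [le_div_iff₀ hq']
    nlinarith [mul_le_mul_of_nonneg_right h1 hq0]

/-- Approximate equilibria of finite two-player games. -/
theorem exists_approx_bimatrix {α β : Type*} [Fintype α] [Fintype β] [Nonempty α]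
    [Nonempty β] (u v : α → β → ℝ) {K : ℝ} (hu : ∀ a b, u a b ∈ Set.Icc 0 K)
    (hv : ∀ a b, v a b ∈ Set.Icc 0 K) {η : ℝ} (hη : 0 < η) :
    ∃ (x : α → ℝ) (y : β → ℝ), (∀ a, 0 ≤ x a) ∧ ∑ a, x a = 1 ∧ (∀ b, 0 ≤ y b) ∧ ∑ b, y b = 1 ∧
      (∀ a, ∑ b, u a b * y b ≤ ∑ a, x a * ∑ b, u a b * y b + η) ∧
      ∀ b, ∑ a, v a b * x a ≤ ∑ b, y b * ∑ a, v a b * x a + η := by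
  have hK : 0 ≤ K :=
    (hu (Classical.arbitrary α) (Classical.arbitrary β)).1.trans (hu _ _).2
  -- Equilibria are unaffected by `r ↦ 1 + r / L`, with errors scaled by `1 / L`; adding `1` avoids
  -- division by zero.
  set L := K + 1 with hL
  have hL0 : 0 < L := by linarith
  have hmem : ∀ r ∈ Set.Icc 0 K, 1 + r / L ∈ Set.Icc (1 : ℝ) 2 := by
    rintro r ⟨h0, h1⟩
    have : r / L ≤ 1 := (div_le_one hL0).2 (by linarith)
    have : 0 ≤ r / L := by positivity
    constructor <;> linarith
  obtain ⟨x, y, hx0, hx1, hy0, hy1, hx, hy⟩ := exists_approx_bimatrix_of_mem_Icc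
    (fun a b => 1 + u a b / L) (fun a b => 1 + v a b / L) (fun a b => hmem _ (hu a b))
    (fun a b => hmem _ (hv a b)) (div_pos hη hL0)
  refine ⟨x, y, hx0, hx1, hy0, hy1, fun a => ?_, fun b => ?_⟩
  · have hs : ∀ a, ∑ b, (1 + u a b / L) * y b = 1 + (∑ b, u a b * y b) / L := fun a => by
      simp only [add_mul, one_mul, Finset.sum_add_distrib, hy1, Finset.sum_div]
      congr 1
      exact Finset.sum_congr rfl fun l _ => by ring
    have h := hx a
    simp only [hs, mul_add, mul_one, Finset.sum_add_distrib, hx1, ← mul_div_assoc,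
      ← Finset.sum_div] at h
    rw [add_assoc, add_le_add_iff_left, ← add_div] at h
    exact (div_le_div_iff_of_pos_right hL0).1 h
  · have hs : ∀ b, ∑ a, (1 + v a b / L) * x a = 1 + (∑ a, v a b * x a) / L := fun b => by
      simp only [add_mul, one_mul, Finset.sum_add_distrib, hx1, Finset.sum_div]
      congr 1
      exact Finset.sum_congr rfl fun l _ => by ring
    have h := hy b
    simp only [hs, mul_add, mul_one, Finset.sum_add_distrib, hy1, ← mul_div_assoc,
      ← Finset.sum_div] at h
    rw [add_assoc, add_le_add_iff_left, ← add_div] at h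
    exact (div_le_div_iff_of_pos_right hL0).1 h

end FiniteGames

end DiscountedGame

namespace DiscountedGame

/-! ### Approximate equilibria in mixed strategies of infinite games -/

section MixedStrategies

/-- A bounded subset of the finite-dimensional space `J → ℝ` is totally bounded. -/
theorem exists_finset_approx {P J : Type*} [Fintype J] (f : P → J → ℝ) {K : ℝ}
    (hf : ∀ p j, |f p j| ≤ K) {η : ℝ} (hη : 0 < η) :
    ∃ F : Finset P, ∀ p, ∃ p' ∈ F, ∀ j, |f p j - f p' j| ≤ η := by
  classical
  have hb : Set.range f ⊆ Metric.closedBall 0 (max K 0) := by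
    rintro - ⟨p, rfl⟩
    rw [mem_closedBall_zero_iff, pi_norm_le_iff_of_nonneg (le_max_right _ _)]
    exact fun j => (hf p j).trans (le_max_left _ _)
  obtain ⟨t, hts, htf, ht⟩ := Metric.finite_approx_of_totallyBounded ((isCompact_closedBall _ _).totallyBounded.subset hb) η hη
  choose g hg using fun y : t => hts y.2
  have := htf.fintype
  refine ⟨Finset.univ.image g, fun p => ?_⟩
  obtain ⟨y, hy, hpy⟩ := Set.mem_iUnion₂.1 (ht ⟨p, rfl⟩)
  refine ⟨g ⟨y, hy⟩, Finset.mem_image_of_mem g (Finset.mem_univ _), fun j => ?_⟩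
  rw [hg, ← Real.dist_eq]
  exact (dist_le_pi_dist _ _ j).trans (Metric.mem_ball.1 hpy).le

/-! ### Expected payoffs against finitely supported mixed strategies -/

theorem hasSum_toReal {P : Type*} (S : PMF P) : HasSum (fun p => (S p).toReal) 1 := by
  have h := ENNReal.hasSum_toReal S.tsum_coe_ne_top
  rwa [← ENNReal.tsum_toReal_eq S.apply_ne_top, S.tsum_coe, ENNReal.toReal_one] at h

theorem mixed_eq_tsum {P Q : Type*} (u : P → Q → ℝ) (S : PMF P) {T : PMF Q} {F : Finset Q}
    (hT : ∀ q ∉ F, T q = 0) :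
    mixed u S T = ∑' p, (S p).toReal * ∑ q ∈ F, u p q * (T q).toReal := by
  refine tsum_congr fun p => ?_
  rw [tsum_eq_sum (s := F) fun q hq => by simp [hT q hq], Finset.mul_sum]
  exact Finset.sum_congr rfl fun q _ => by ring

theorem mixed_eq_sum {P Q : Type*} (u : P → Q → ℝ) {S : PMF P} {T : PMF Q} {E : Finset P}
    {F : Finset Q} (hS : ∀ p ∉ E, S p = 0) (hT : ∀ q ∉ F, T q = 0) :
    mixed u S T = ∑ p ∈ E, (S p).toReal * ∑ q ∈ F, u p q * (T q).toReal := by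
  rw [mixed_eq_tsum u S hT, tsum_eq_sum (s := E) fun p hp => by simp [hS p hp]]

theorem mixed_le {P Q : Type*} {u : P → Q → ℝ} (hu : ∀ p q, 0 ≤ u p q) (S : PMF P) {T : PMF Q}
    {F : Finset Q} (hT : ∀ q ∉ F, T q = 0) {W : ℝ}
    (hW : ∀ p, ∑ q ∈ F, u p q * (T q).toReal ≤ W) : mixed u S T ≤ W := by
  rw [mixed_eq_tsum u S hT]
  have hsum := (hasSum_toReal S).mul_right W
  rw [one_mul] at hsum
  have hle : ∀ p, (S p).toReal * ∑ q ∈ F, u p q * (T q).toReal ≤ (S p).toReal * W := fun p =>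
    mul_le_mul_of_nonneg_left (hW p) ENNReal.toReal_nonneg
  refine (Summable.tsum_le_tsum hle ?_ hsum.summable).trans_eq hsum.tsum_eq
  exact Summable.of_nonneg_of_le (fun p => mul_nonneg ENNReal.toReal_nonneg
    (Finset.sum_nonneg fun q _ => mul_nonneg (hu p q) ENNReal.toReal_nonneg)) hle hsum.summable

theorem mixed_comm {P Q : Type*} {v : P → Q → ℝ} {K : ℝ} (hv : ∀ p q, v p q ∈ Set.Icc 0 K)
    {S : PMF P} {F : Finset P} (hS : ∀ p ∉ F, S p = 0) (T : PMF Q) :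
    mixed v S T = mixed (fun q p => v p q) T S := by
  have hsum : ∀ p, Summable fun q => (S p).toReal * (T q).toReal * v p q := fun p => by
    refine Summable.of_nonneg_of_le (fun q => mul_nonneg (mul_nonneg ENNReal.toReal_nonneg
      ENNReal.toReal_nonneg) (hv p q).1) (fun q => mul_le_mul_of_nonneg_left (hv p q).2
      (mul_nonneg ENNReal.toReal_nonneg ENNReal.toReal_nonneg)) ?_
    exact ((hasSum_toReal T).summable.mul_left _).mul_right K
  rw [mixed_eq_tsum _ T hS, mixed, tsum_eq_sum (s := F) fun p hp => by simp [hS p hp],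
    ← Summable.tsum_finsetSum fun p _ => hsum p]
  refine tsum_congr fun q => ?_
  rw [Finset.mul_sum]
  exact Finset.sum_congr rfl fun p _ => by ring

open Classical in
theorem exists_pmf_of_weights {P : Type*} {F : Finset P} (x : F → ℝ) (hx0 : ∀ p, 0 ≤ x p)
    (hx1 : ∑ p, x p = 1) :
    ∃ S : PMF P, (∀ p ∉ F, S p = 0) ∧
      ∀ g : P → ℝ, ∑ p ∈ F, g p * (S p).toReal = ∑ p : F, g p * x p := by
  refine ⟨PMF.ofFinset (fun p => if h : p ∈ F then ENNReal.ofReal (x ⟨p, h⟩) else 0) F ?_ ?_,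
    ?_, ?_⟩
  · rw [← Finset.sum_coe_sort]
    simp only [Finset.coe_mem, dif_pos, Subtype.coe_eta]
    rw [← ENNReal.ofReal_sum_of_nonneg fun p _ => hx0 p, hx1, ENNReal.ofReal_one]
  · intro p hp
    simp [hp]
  · intro p hp
    simp [hp]
  · intro g
    rw [← Finset.sum_coe_sort]
    refine Finset.sum_congr rfl fun p _ => ?_
    simp [ENNReal.toReal_ofReal (hx0 p)]

/-- A game with bounded payoffs has approximate equilibria if the strategies of player 1 are
totally bounded in the uniform distance of the resulting payoffs of player 1. -/
theorem exists_isApproxNash {P Q : Type*} [Nonempty P] [Nonempty Q] (u v : P → Q → ℝ) {K : ℝ}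
    (hu : ∀ p q, u p q ∈ Set.Icc 0 K) (hv : ∀ p q, v p q ∈ Set.Icc 0 K)
    (htb : ∀ η > 0, ∃ F : Finset P, ∀ p, ∃ p' ∈ F, ∀ q, |u p q - u p' q| ≤ η)
    {η : ℝ} (hη : 0 < η) : ∃ (S : PMF P) (T : PMF Q), IsApproxNash u v η S T := by
  obtain ⟨E, hE⟩ := htb (η / 2) (by positivity)
  -- Player 1 will mix only over `E`, so player 2's strategies need approximating only against `E`.
  obtain ⟨F, hF⟩ := exists_finset_approx (fun q (p : E) => v p q) (K := K)
    (fun q p => abs_le.2 ⟨by linarith [(hv p q).1, (hv p q).2], (hv p q).2⟩) (half_pos hη)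
  have : Nonempty E := by
    obtain ⟨p, hp, -⟩ := hE (Classical.arbitrary P)
    exact ⟨⟨p, hp⟩⟩
  have : Nonempty F := by
    obtain ⟨q, hq, -⟩ := hF (Classical.arbitrary Q)
    exact ⟨⟨q, hq⟩⟩
  obtain ⟨x, y, hx0, hx1, hy0, hy1, hx, hy⟩ := exists_approx_bimatrix
    (fun (p : E) (q : F) => u p q) (fun p q => v p q) (fun p q => hu p q) (fun p q => hv p q)
    (half_pos hη)
  obtain ⟨S, hS, hSx⟩ := exists_pmf_of_weights x hx0 hx1
  obtain ⟨T, hT, hTy⟩ := exists_pmf_of_weights y hy0 hy1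
  refine ⟨S, T, fun S' => ?_, fun T' => ?_⟩
  · have hval : mixed u S T = ∑ p : E, x p * ∑ q : F, u p q * y q := by
      rw [mixed_eq_sum u hS hT]
      simp only [hTy]
      simpa only [mul_comm] using hSx fun p => ∑ q : F, u p q * y q
    refine mixed_le (fun p q => (hu p q).1) S' hT fun p => ?_
    obtain ⟨p', hp', hpp'⟩ := hE p
    rw [hTy, hval]
    have h1 : ∑ q : F, u p q * y q ≤ ∑ q : F, (u p' q * y q + η / 2 * y q) :=
      Finset.sum_le_sum fun q _ => by
        rw [← add_mul]
        exact mul_le_mul_of_nonneg_right (by linarith [(abs_le.1 (hpp' q)).2]) (hy0 q)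
    rw [Finset.sum_add_distrib, ← Finset.mul_sum, hy1] at h1
    linarith [hx ⟨p', hp'⟩]
  · have hval : mixed (fun q p => v p q) T S = ∑ q : F, y q * ∑ p : E, v p q * x p := by
      rw [mixed_eq_sum _ hT hS]
      simp only [fun q => hSx fun p => v p q]
      simpa only [mul_comm] using hTy fun q => ∑ p : E, v p q * x p
    rw [mixed_comm hv hS, mixed_comm hv hS]
    refine mixed_le (fun q p => (hv p q).1) T' hS fun q => ?_
    obtain ⟨q', hq', hqq'⟩ := hF q
    rw [hSx fun p => v p q, hval]
    have h1 : ∑ p : E, v p q * x p ≤ ∑ p : E, (v p q' * x p + η / 2 * x p) :=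
      Finset.sum_le_sum fun p _ => by
        rw [← add_mul]
        exact mul_le_mul_of_nonneg_right (by linarith [(abs_le.1 (hqq' p)).2]) (hx0 p)
    rw [Finset.sum_add_distrib, ← Finset.mul_sum, hx1] at h1
    linarith [hy ⟨q', hq'⟩]

end MixedStrategies

end DiscountedGame

namespace DiscountedGame

/-! ### Computation paths -/

instance : IsProbabilityMeasure coins := by
  unfold coins
  infer_instance

/-- Such a set is the preimage of a subset of the finite space of the first `t` coins. -/
theorem measurableSet_of_finite_dependence {A : Set (ℕ → Bool)} (t : ℕ)
    (h : ∀ ω ω' : ℕ → Bool, (∀ i < t, ω i = ω' i) → ω ∈ A → ω' ∈ A) : MeasurableSet A := by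
  have hA : A = (fun (ω : ℕ → Bool) (i : Fin t) => ω i) ⁻¹'
      ((fun (ω : ℕ → Bool) (i : Fin t) => ω i) '' A) := by
    refine Set.Subset.antisymm (Set.subset_preimage_image _ _) ?_
    rintro ω' ⟨ω, hω, heq⟩
    exact h ω ω' (fun i hi => congrFun heq ⟨i, hi⟩) hω
  rw [hA]
  exact (measurable_pi_lambda _ fun i => measurable_pi_apply _) (Set.toFinite _).measurableSet

/-! ### Output length and measurability of the result of a computation -/

namespace PTM

theorem run_congr (M : PTM) (inp : List (Option Bool)) {ω ω' : ℕ → Bool} :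
    ∀ t, (∀ i < t, ω i = ω' i) → M.run inp ω t = M.run inp ω' t
  | 0, _ => rfl
  | t + 1, h => by
    rw [run, run, h t (Nat.lt_succ_self t), run_congr M inp t fun i hi => h i (Nat.lt_succ_of_lt hi)]

theorem length_out_step (M : PTM) (b : Bool) (c : M.Cfg) :
    (M.step b c).out.length ≤ c.out.length + 1 := by
  unfold step
  split
  · omega
  · simp only [List.length_append, add_le_add_iff_left]
    exact Option.length_toList_le

theorem length_out_run (M : PTM) (inp : List (Option Bool)) (ω : ℕ → Bool) (t : ℕ) :
    (M.run inp ω t).out.length ≤ t := by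
  induction t with
  | zero => exact le_rfl
  | succ t ih =>
    rw [run]
    exact (M.length_out_step _ _).trans (Nat.succ_le_succ ih)

theorem outcome_eq_some_iff (M : PTM) (inp : List (Option Bool)) (ω : ℕ → Bool) (x : List Bool)
    (t : ℕ) : M.outcome inp ω = some (x, t) ↔ (M.run inp ω t).state = none ∧
      (∀ s < t, (M.run inp ω s).state ≠ none) ∧ (M.run inp ω t).out = x := by
  classical
  unfold outcome
  constructor
  · intro h
    split at h
    · rename_i hex
      rw [Option.some.injEq, Prod.mk.injEq] at h
      obtain ⟨h1, h2⟩ := h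
      obtain ⟨h3, h4⟩ := (Nat.find_eq_iff hex).1 h2
      rw [h2] at h1
      exact ⟨h3, h4, h1⟩
    · cases h
  · rintro ⟨h1, h2, h3⟩
    have hex : ∃ t, (M.run inp ω t).state = none := ⟨t, h1⟩
    have hfind : Nat.find hex = t := (Nat.find_eq_iff hex).2 ⟨h1, h2⟩
    rw [dif_pos hex, hfind, h3]

theorem length_le_of_outcome_eq_some {M : PTM} {inp : List (Option Bool)} {ω : ℕ → Bool}
    {x : List Bool} {t : ℕ} (h : M.outcome inp ω = some (x, t)) : x.length ≤ t := by
  obtain ⟨-, -, rfl⟩ := (M.outcome_eq_some_iff inp ω x t).1 h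
  exact M.length_out_run inp ω t

theorem measurableSet_outcome_eq_some (M : PTM) (inp : List (Option Bool)) (s : List Bool × ℕ) :
    MeasurableSet {ω | M.outcome inp ω = some s} := by
  obtain ⟨x, t⟩ := s
  refine measurableSet_of_finite_dependence t fun ω ω' h hω => ?_
  rw [Set.mem_ofPred_eq, outcome_eq_some_iff] at hω ⊢
  have hrun : ∀ s ≤ t, M.run inp ω s = M.run inp ω' s := fun s hs =>
    M.run_congr inp s fun i hi => h i (hi.trans_le hs)
  exact ⟨hrun t le_rfl ▸ hω.1, fun s hs => hrun s hs.le ▸ hω.2.1 s hs, hrun t le_rfl ▸ hω.2.2⟩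

theorem measurable_comp_outcome (M : PTM) (inp : List (Option Bool))
    (g : Option (List Bool × ℕ) → ℝ) : Measurable fun ω => g (M.outcome inp ω) := by
  let _ : MeasurableSpace (Option (List Bool × ℕ)) := ⊤
  have hm : Measurable (M.outcome inp) := by
    refine measurable_to_countable' fun o => ?_
    cases o with
    | some s => exact M.measurableSet_outcome_eq_some inp s
    | none =>
      have : M.outcome inp ⁻¹' {none} = (⋃ s, {ω | M.outcome inp ω = some s})ᶜ := by
        ext ω
        simp [Option.eq_none_iff_forall_ne_some]
      rw [this]
      exact (MeasurableSet.iUnion fun s => M.measurableSet_outcome_eq_some inp s).compl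
  exact measurable_from_top.comp hm

end PTM

/-! ### Payoffs -/

theorem discounted_some_mem_Icc {A B : Type*} {v : A → B → ℝ≥0} {K : ℝ≥0} (hv : ∀ a b, v a b ≤ K)
    (rep : List Bool → A) (rep' : List Bool → B) {ε : ℝ} (hε : ε ≤ 1) (x : List Bool) (t : ℕ)
    (s : Option (List Bool × ℕ)) :
    discounted v rep rep' ε (some (x, t)) s ∈ Set.Icc 0 ((1 - ε) ^ t * (K : ℝ)) := by
  have hpow : 0 ≤ (1 - ε) ^ t := pow_nonneg (sub_nonneg.2 hε) t
  rcases s with - | ⟨y, -⟩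
  · exact ⟨mul_nonneg hpow (Real.iSup_nonneg fun b => NNReal.coe_nonneg _),
      mul_le_mul_of_nonneg_left (Real.iSup_le (fun b => hv _ b) K.2) hpow⟩
  · exact ⟨mul_nonneg hpow (NNReal.coe_nonneg _), mul_le_mul_of_nonneg_left (hv _ _) hpow⟩

theorem discounted_mem_Icc {A B : Type*} {v : A → B → ℝ≥0} {K : ℝ≥0} (hv : ∀ a b, v a b ≤ K)
    (rep : List Bool → A) (rep' : List Bool → B) {ε : ℝ} (hε : 0 < ε) (hε' : ε ≤ 1)
    (r s : Option (List Bool × ℕ)) : discounted v rep rep' ε r s ∈ Set.Icc 0 (K : ℝ) := by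
  rcases r with - | ⟨x, t⟩
  · exact ⟨le_rfl, K.2⟩
  · have h := discounted_some_mem_Icc hv rep rep' hε' x t s
    exact ⟨h.1, h.2.trans (mul_le_of_le_one_left K.2
      (pow_le_one₀ (sub_nonneg.2 hε') (sub_le_self 1 hε.le)))⟩

theorem integral_mem_Icc {f : (ℕ → Bool) → ℝ} {K : ℝ} (h : ∀ ω, f ω ∈ Set.Icc 0 K) :
    ∫ ω, f ω ∂coins ∈ Set.Icc 0 K := by
  refine ⟨integral_nonneg fun ω => (h ω).1, ?_⟩
  have hn := norm_integral_le_of_norm_le_const (μ := coins) (f := f) (C := K)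
    (ae_of_all _ fun ω => by rw [Real.norm_of_nonneg (h ω).1]; exact (h ω).2)
  rw [probReal_univ, mul_one] at hn
  exact (le_abs_self _).trans hn

/-- The payoffs of player 1 are determined, up to the discounted payoff of long computations, by
the law of the result of player 1's machine on a finite set of results. -/
theorem abs_payoff₁_sub_sum_le {A₁ A₂ : Type*} (G : Game A₁ A₂) {K : ℝ≥0}
    (hK : ∀ a b, G.u₁ a b ≤ K) (rep₁ : List Bool → A₁) (rep₂ : List Bool → A₂) {ε : ℝ} (δ : ℝ)
    (hε : 0 < ε) (hε' : ε ≤ 1) {T : ℕ} {Z : Finset (List Bool × ℕ)}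
    (hZ : ∀ x t, x.length ≤ t → t ≤ T → (x, t) ∈ Z) (N : PTM) :
    ∃ g : List Bool × ℕ → ℝ, (∀ s, g s ∈ Set.Icc 0 (K : ℝ)) ∧ ∀ M : PTM,
      |payoff₁ G rep₁ rep₂ ε δ M N -
        ∑ s ∈ Z, coins.real {ω | M.outcome (input ε δ []) ω = some s} * g s| ≤
      (1 - ε) ^ T * K := by
  classical
  -- The conditional expectation given player 1's result `o`. It does not involve `M`, since player
  -- 2's input depends on `M` only through `o`.
  set h : Option (List Bool × ℕ) → ℝ := fun o => ∫ ω, discounted G.u₁ rep₁ rep₂ ε o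
    (N.outcome (input ε δ (additionalInput G.order o)) ω) ∂coins with hh
  have hmem : ∀ o, h o ∈ Set.Icc 0 (K : ℝ) := fun o =>
    integral_mem_Icc fun ω => discounted_mem_Icc hK rep₁ rep₂ hε hε' _ _
  have hsome : ∀ x t, h (some (x, t)) ∈ Set.Icc 0 ((1 - ε) ^ t * (K : ℝ)) := fun x t =>
    integral_mem_Icc fun ω => discounted_some_mem_Icc hK rep₁ rep₂ hε' _ _ _
  have hnone : h none = 0 := by simp [hh, discounted]
  have h0 : 0 ≤ (1 - ε) ^ T * (K : ℝ) := mul_nonneg (pow_nonneg (sub_nonneg.2 hε') T) K.2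
  refine ⟨fun s => h (some s), fun s => hmem _, fun M => ?_⟩
  have hint : Integrable (fun ω => h (M.outcome (input ε δ []) ω)) coins :=
    Integrable.of_bound (M.measurable_comp_outcome _ h).aestronglyMeasurable K
      (ae_of_all _ fun ω => by rw [Real.norm_of_nonneg (hmem _).1]; exact (hmem _).2)
  have hind : ∀ s ∈ Z, Integrable ({ω | M.outcome (input ε δ []) ω = some s}.indicator
      fun _ => h (some s)) coins := fun s _ =>
    (integrable_const _).indicator (M.measurableSet_outcome_eq_some _ s)
  have heq : payoff₁ G rep₁ rep₂ ε δ M N -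
      ∑ s ∈ Z, coins.real {ω | M.outcome (input ε δ []) ω = some s} * h (some s) =
      ∫ ω, (h (M.outcome (input ε δ []) ω) - ∑ s ∈ Z,
        {ω | M.outcome (input ε δ []) ω = some s}.indicator (fun _ => h (some s)) ω) ∂coins := by
    rw [integral_sub hint (integrable_finsetSum _ hind), integral_finsetSum _ hind]
    congr 1
    refine Finset.sum_congr rfl fun s _ => ?_
    rw [integral_indicator_const _ (M.measurableSet_outcome_eq_some _ s), smul_eq_mul]
  rw [heq, ← Real.norm_eq_abs]
  refine (norm_integral_le_of_norm_le_const (C := (1 - ε) ^ T * (K : ℝ))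
    (ae_of_all _ fun ω => ?_)).trans_eq (by rw [probReal_univ, mul_one])
  rcases ho : M.outcome (input ε δ []) ω with - | ⟨x, t⟩
  · simpa [hnone, Set.indicator, ho] using h0
  · have hsum : ∑ s ∈ Z, {ω | M.outcome (input ε δ []) ω = some s}.indicator
        (fun _ => h (some s)) ω = if (x, t) ∈ Z then h (some (x, t)) else 0 := by
      simp [Set.indicator, ho]
    rw [hsum]
    split_ifs with hxt
    · simpa using h0
    · have hTt : T ≤ t := by
        by_contra! hlt
        exact hxt (hZ x t (PTM.length_le_of_outcome_eq_some ho) hlt.le)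
      rw [sub_zero, Real.norm_of_nonneg (hsome x t).1]
      exact (hsome x t).2.trans (mul_le_mul_of_nonneg_right
        (pow_le_pow_of_le_one (sub_nonneg.2 hε') (sub_le_self 1 hε.le) hTt) K.2)

theorem exists_finset_payoff₁_approx {A₁ A₂ : Type*} (G : Game A₁ A₂) {K : ℝ≥0}
    (hK : ∀ a b, G.u₁ a b ≤ K) (rep₁ : List Bool → A₁) (rep₂ : List Bool → A₂) {ε : ℝ} (δ : ℝ)
    (hε : 0 < ε) (hε' : ε ≤ 1) {η : ℝ} (hη : 0 < η) :
    ∃ F : Finset PTM, ∀ M, ∃ M' ∈ F, ∀ N,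
      |payoff₁ G rep₁ rep₂ ε δ M N - payoff₁ G rep₁ rep₂ ε δ M' N| ≤ η := by
  have hK0 : 0 ≤ (K : ℝ) := K.2
  -- The two tails cost `η / 4` each, leaving `η / 2` for the probabilities of the results in `Z`.
  obtain ⟨T, hT⟩ := exists_pow_lt_of_lt_one (show 0 < η / (4 * (K + 1)) by positivity)
    (sub_lt_self 1 hε)
  have hTK : (1 - ε) ^ T * (K : ℝ) ≤ η / 4 := by
    calc (1 - ε) ^ T * (K : ℝ) ≤ η / (4 * (K + 1)) * (K + 1) := by
          gcongr
          linarith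
      _ = η / 4 := by field_simp
  set Z : Finset (List Bool × ℕ) :=
    (List.finite_length_le Bool T).toFinset ×ˢ Finset.range (T + 1) with hZdef
  have hZ : ∀ x t, x.length ≤ t → t ≤ T → (x, t) ∈ Z := fun x t h1 h2 => by
    rw [hZdef, Finset.mem_product, Set.Finite.mem_toFinset, Finset.mem_range]
    exact ⟨h1.trans h2, Nat.lt_succ_of_le h2⟩
  obtain ⟨F, hF⟩ := exists_finset_approx
    (fun (M : PTM) (s : Z) => coins.real {ω | M.outcome (input ε δ []) ω = some s.1}) (K := 1)
    (fun M s => by rw [abs_of_nonneg measureReal_nonneg]; exact measureReal_le_one)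
    (show 0 < η / (2 * (Z.card * K + 1)) by positivity)
  refine ⟨F, fun M => ?_⟩
  obtain ⟨M', hM', hMM'⟩ := hF M
  refine ⟨M', hM', fun N => ?_⟩
  obtain ⟨g, hg, happ⟩ := abs_payoff₁_sub_sum_le G hK rep₁ rep₂ δ hε hε' hZ N
  have hsum : |∑ s ∈ Z, coins.real {ω | M.outcome (input ε δ []) ω = some s} * g s -
      ∑ s ∈ Z, coins.real {ω | M'.outcome (input ε δ []) ω = some s} * g s| ≤ η / 2 := by
    rw [← Finset.sum_sub_distrib]
    refine (Finset.abs_sum_le_sum_abs _ _).trans ?_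
    calc _ ≤ ∑ s ∈ Z, η / (2 * (Z.card * K + 1)) * K := by
          refine Finset.sum_le_sum fun s hs => ?_
          rw [← sub_mul, abs_mul, abs_of_nonneg (hg s).1]
          exact mul_le_mul (hMM' ⟨s, hs⟩) (hg s).2 (hg s).1 (by positivity)
      _ = η / (2 * (Z.card * K + 1)) * (Z.card * K) := by
          rw [Finset.sum_const, nsmul_eq_mul]
          ring
      _ ≤ η / (2 * (Z.card * K + 1)) * (Z.card * K + 1) := by
          gcongr
          linarith
      _ = η / 2 := by field_simp
  have h1 := abs_le.1 ((happ M).trans hTK)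
  have h2 := abs_le.1 ((happ M').trans hTK)
  have h3 := abs_le.1 hsum
  rw [abs_le]
  constructor <;> linarith [h1.1, h1.2, h2.1, h2.2, h3.1, h3.2]

instance : Nonempty PTM :=
  ⟨⟨0, 0, 0, fun _ _ _ => (none, fun _ => (Sym.blank, none), none)⟩⟩

end DiscountedGame

theorem theorem5 {A₁ A₂ : Type*} [Countable A₁] [Countable A₂]
    (G : DiscountedGame.Game A₁ A₂)
    (bounded : ∃ K : ℝ≥0, ∀ a b, G.u₁ a b ≤ K ∧ G.u₂ a b ≤ K)
    (rep₁ : List Bool → A₁) (hrep₁ : Function.Surjective rep₁)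
    (rep₂ : List Bool → A₂) (hrep₂ : Function.Surjective rep₂)
    (ε δ : ℝ) (hε : 0 < ε) (hε' : ε ≤ 1) (hδ : 0 < δ) (hδ' : δ ≤ 1) :
    ∃ S T : PMF DiscountedGame.PTM,
      DiscountedGame.IsApproxNash (DiscountedGame.payoff₁ G rep₁ rep₂ ε δ)
        (DiscountedGame.payoff₂ G rep₁ rep₂ ε δ) (ε + δ) S T := by
  obtain ⟨K, hK⟩ := bounded
  refine DiscountedGame.exists_isApproxNash _ _ (K := K) (fun M N => ?_) (fun M N => ?_)
    (fun η hη => DiscountedGame.exists_finset_payoff₁_approx G (fun a b => (hK a b).1) rep₁ rep₂ δ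
      hε hε' hη) (add_pos hε hδ)
  · exact DiscountedGame.integral_mem_Icc fun ω => DiscountedGame.integral_mem_Icc fun ω' =>
      DiscountedGame.discounted_mem_Icc (fun a b => (hK a b).1) _ _ hε hε' _ _
  · exact DiscountedGame.integral_mem_Icc fun ω => DiscountedGame.integral_mem_Icc fun ω' =>
      DiscountedGame.discounted_mem_Icc (fun b a => (hK a b).2) _ _ hδ hδ' _ _
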